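/- Let $\Pi$ be an orthogonal projector on a finite-dimensional Hilbert space with a distinguished basis state $|0\rangle$. Suppose we have query access to a unitary oracle $O_\psi$ (and its inverse) with $O_\psi|0\rangle=|\psi\rangle$ and to a reflection oracle $R_\Pi$ with $\Pi=(\mathbb 1-R_\Pi)/2$; queries may be controlled. Assume $$\langle\psi|\Pi|\psi\rangle=P_0+\delta,\qquad P_0=\sin^2\!\left(\frac{\pi}{2(2\mu+1)}\right),$$ where the integer $\mu\ge 1$ (hence the upper bound $P_0$) is known and $\delta\in[-P_0,0)$ is unknown. Then there is a quantum algorithm that estimates $\delta$, and hence $\langle\psi|\Pi|\psi\rangle$, within error $\epsilon\in O(P_0^2/|\delta|)$ and with failure probability at most $\delta'$, using $$N_{\rm queries}\in O\!\left(\frac{P_0^{1/2}\log(1/\delta')}{\epsilon}\cdot\frac{P_0}{|\delta|}\right)$$ queries to $R_\Pi$ and $O_\psi$. Precisely: for every $c>0$ there is $C>0$ such that for all integers $\mu\ge1$ and all $\epsilon>0$, $\delta'\in(0,1)$ there is an algorithm, depending on $\mu,\epsilon,\delta'$ but not on $\delta$ or on the oracles, with the following property. For all oracles and all $\delta\in[-P_0,0)$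 as above with $\epsilon\le c\,P_0^2/|\delta|$, the algorithm makes at most $C\,\frac{P_0^{1/2}\log(1/\delta')}{\epsilon}\cdot\frac{P_0}{|\delta|}$ queries and outputs $\hat\delta$ with $\Pr[|\hat\delta-\delta|>\epsilon]\le\delta'$; since $P_0$ is known, $P_0+\hat\delta$ then estimates $\langle\psi|\Pi|\psi\rangle$ with the same error and failure probability. Moreover, the algorithm can be chosen to be of amplified amplitude estimation form: writing $$W=-(\mathbb 1-2|\psi\rangle\langle\psi|)R_\Pi,\qquad W'=-\left(\mathbb 1-2W^\mu|\psi\rangle\langle\psi|(W^\mu)^\dagger\right)R_\Pi ,$$ it acts on an ancilla register and on the system, started in a basis state of the ancilla tensored with $|0\rangle$, only by applications of $O_\psi$ to the system, unitaries on the ancilla alone, and applications of $W'$ controlled by the ancilla (each compiled into queries to $O_\psi$, $O_\psi^\dagger$ and $R_\Pi$, all of which are counted), followed by a measurement of the ancilla and classical post-processing. -/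

import Mathlib

open scoped Matrix Kronecker

namespace AAE

noncomputable section

/-- The upper bound `P₀ = sin² (π / (2 (2 μ + 1)))`. -/
def P0 (μ : ℕ) : ℝ := Real.sin (Real.pi / (2 * (2 * (μ : ℝ) + 1))) ^ 2

section Model

variable {S A : Type} [Fintype S] [DecidableEq S] [Fintype A] [DecidableEq A]

/-- The computational basis vector labelled `i`. -/
def ket {I : Type} [DecidableEq I] (i : I) : I → ℂ := Pi.single i 1

/-- The operator on system ⊗ ancilla that applies `U` to the system if the ancilla is in a basis
state `a` with `c a = true`, and does nothing otherwise. `c = fun _ => true` is no control. -/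
def controlled (c : A → Bool) (U : Matrix S S ℂ) : Matrix (S × A) (S × A) ℂ :=
  Matrix.blockDiagonal fun a => if c a then U else 1

theorem controlled_mem_unitaryGroup (c : A → Bool) {U : Matrix S S ℂ}
    (hU : U ∈ Matrix.unitaryGroup S ℂ) :
    controlled c U ∈ Matrix.unitaryGroup (S × A) ℂ := by
  rw [Matrix.mem_unitaryGroup_iff'] at hU ⊢
  rw [controlled, Matrix.star_eq_conjTranspose, Matrix.blockDiagonal_conjTranspose,
    ← Matrix.blockDiagonal_mul, ← Matrix.blockDiagonal_one]
  congr 1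
  funext a
  by_cases h : c a
  · simpa [h, Matrix.star_eq_conjTranspose] using hU
  · simp [h]

/-- The operator `-(1 - 2 |s₀⟩⟨s₀|)` on the system. -/
def zeroReflection (s₀ : S) : Matrix S S ℂ :=
  -(1 - (2 : ℂ) • Matrix.vecMulVec (ket s₀) (star (ket s₀)))

theorem zeroReflection_eq_diagonal {S : Type} [DecidableEq S] (s₀ : S) :
    zeroReflection s₀ = Matrix.diagonal fun s => if s = s₀ then (1 : ℂ) else -1 := by
  ext i j
  by_cases hij : i = j
  · subst hij
    by_cases hi : i = s₀
    · subst hi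
      simp [zeroReflection, ket, Matrix.vecMulVec_apply]
      norm_num
    · simp [zeroReflection, ket, Matrix.vecMulVec_apply, hi]
  · by_cases hi : i = s₀
    · subst hi
      have hj : j ≠ i := fun h => hij h.symm
      simp [zeroReflection, ket, Matrix.vecMulVec_apply, hij, hj]
    · simp [zeroReflection, ket, Matrix.vecMulVec_apply, hij, hi]

theorem zeroReflection_mem_unitaryGroup (s₀ : S) :
    zeroReflection s₀ ∈ Matrix.unitaryGroup S ℂ := by
  rw [Matrix.mem_unitaryGroup_iff', zeroReflection_eq_diagonal, Matrix.star_eq_conjTranspose,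
    Matrix.diagonal_conjTranspose, Matrix.diagonal_mul_diagonal, ← Matrix.diagonal_one]
  congr 1
  funext s
  by_cases h : s = s₀ <;> simp [h]

/-- Gates of a quantum query circuit on system ⊗ ancilla: an arbitrary unitary that does not depend
on the oracles, or one (possibly controlled) query to the preparation oracle, to its inverse, or to
the reflection oracle. -/
inductive Gate (S A : Type) [Fintype S] [DecidableEq S] [Fintype A] [DecidableEq A] : Type
  | free (U : Matrix.unitaryGroup (S × A) ℂ) : Gate S A
  | prep (c : A → Bool) : Gate S A
  | prepInv (c : A → Bool) : Gate S A
  | refl (c : A → Bool) : Gate S A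

/-- The operator performed by a gate when the preparation oracle is `O` and the reflection oracle
is `R`. -/
def Gate.toMatrix (O R : Matrix S S ℂ) : Gate S A → Matrix (S × A) (S × A) ℂ
  | .free U => U.1
  | .prep c => controlled c O
  | .prepInv c => controlled c Oᴴ
  | .refl c => controlled c R

/-- The number of oracle queries made by a gate. -/
def Gate.queries : Gate S A → ℕ
  | .free _ => 0
  | .prep _ => 1
  | .prepInv _ => 1
  | .refl _ => 1

/-- A query circuit is a list of gates; the head of the list is applied first. -/
abbrev Circuit (S A : Type) [Fintype S] [DecidableEq S] [Fintype A] [DecidableEq A] : Type :=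
  List (Gate S A)

/-- The total number of oracle queries made by a circuit. -/
def Circuit.queries (C : Circuit S A) : ℕ := (C.map Gate.queries).sum

/-- The final state of a circuit started in the state `v`. -/
def Circuit.run (O R : Matrix S S ℂ) (C : Circuit S A) (v : S × A → ℂ) : S × A → ℂ :=
  C.foldl (fun w g => g.toMatrix O R *ᵥ w) v

/-- Born probability that a measurement of the ancilla of the state `v` in the computational basis
gives an outcome in `E`. -/
def measureProb (v : S × A → ℂ) (E : Set A) : ℝ :=
  ∑ a, E.indicator (fun a => ∑ s, ‖v (s, a)‖ ^ 2) a

/-- Gate for the controlled operator `-(1 - 2 |s₀⟩⟨s₀|)`. -/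
def zeroGate (s₀ : S) (c : A → Bool) : Gate S A :=
  .free ⟨controlled c (zeroReflection s₀),
    controlled_mem_unitaryGroup c (zeroReflection_mem_unitaryGroup s₀)⟩

/-- Gate for a unitary `V` acting on the ancilla only. -/
def ancillaGate (V : Matrix.unitaryGroup A ℂ) : Gate S A :=
  .free ⟨(1 : Matrix S S ℂ) ⊗ₖ V.1, Matrix.kronecker_mem_unitary (one_mem _) V.2⟩

/-- Circuit for the controlled walk operator
`W = -(1 - 2 |ψ⟩⟨ψ|) R = O (-(1 - 2 |s₀⟩⟨s₀|)) Oᴴ R`, where `|ψ⟩ = O |s₀⟩`. -/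
def walkCircuit (s₀ : S) (c : A → Bool) : Circuit S A :=
  [.refl c, .prepInv c, zeroGate s₀ c, .prep c]

/-- Circuit for the controlled inverse `Wᴴ = R O (-(1 - 2 |s₀⟩⟨s₀|)) Oᴴ` of the walk operator. -/
def walkInvCircuit (s₀ : S) (c : A → Bool) : Circuit S A :=
  [.prepInv c, zeroGate s₀ c, .prep c, .refl c]

/-- Circuit for the controlled amplified walk operator
`W' = -(1 - 2 W ^ μ O |s₀⟩⟨s₀| Oᴴ (W ^ μ)ᴴ) R`. -/
def amplifiedWalkCircuit (s₀ : S) (μ : ℕ) (c : A → Bool) : Circuit S A :=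
  [.refl c]
    ++ ((List.replicate μ (walkInvCircuit s₀ c)).flatten
    ++ ([.prepInv c, zeroGate s₀ c, .prep c]
    ++ (List.replicate μ (walkCircuit s₀ c)).flatten))

/-- Steps of an amplitude estimation protocol run on the amplified walk operator: prepare the state
(one use of the preparation oracle on the system), process the ancilla by a unitary, or apply the
amplified walk operator controlled by the ancilla. -/
inductive Step (A : Type) [Fintype A] [DecidableEq A] : Type
  | prepare : Step A
  | ancilla (V : Matrix.unitaryGroup A ℂ) : Step A
  | amplifiedWalk (c : A → Bool) : Step A

/-- The query circuit of one step, with `μ` rounds of amplification. -/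
def Step.toCircuit (s₀ : S) (μ : ℕ) : Step A → Circuit S A
  | .prepare => [.prep fun _ => true]
  | .ancilla V => [ancillaGate V]
  | .amplifiedWalk c => amplifiedWalkCircuit s₀ μ c

/-- The query circuit of a protocol; the head of the list of steps comes first. -/
def protocolCircuit (s₀ : S) (μ : ℕ) (steps : List (Step A)) : Circuit S A :=
  (steps.map (Step.toCircuit s₀ μ)).flatten

end Model

end

end AAE

/-!
The proof rests on two facts about the walk operator `W = S R`, where `S = 2 |ψ⟩⟨ψ| - 1`.

First, the amplified walk operator is a power of it: since the reflection about `W ^ μ |ψ⟩` is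
`(S R) ^ μ S (R S) ^ μ`, one has `W' = W ^ (2 μ + 1)` (`run_amplifiedWalkCircuit`). Secondly,
`W² ψ = 2 cos y W ψ - ψ` with `cos y = 1 - 2 ⟨ψ|Π|ψ⟩`, so `⟨W ^ j ψ, W ^ k ψ⟩ = cos ((k - j) y)`
(`star_walk_pow_mulVec_dotProduct`). This Gram matrix is that of an equal superposition of two
eigenvectors of phases `± y`, so every measurement of an ancilla that controls `W'` is distributed
as if the system were in an equal mixture of eigenvectors of `W'` with phases `± x`, where
`x = (2 μ + 1) y` (`prob_phaseEstimation`). No eigenvectors are needed, and the degenerate case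
`Π ψ = 0` is not special.

Because `⟨ψ|Π|ψ⟩ ≤ P₀`, the phase `x` lies in `[0, π]` and determines `δ` (`exists_phase`); since
`d(sin² θ) = sin (2 θ) dθ` and `θ = x / (2 (2 μ + 1))`, an error `r` in `x` is an error of at most
`2 P₀ r` in `δ` (`abs_phaseToEstimate_sub_le`). So `r` of order `ε / P₀` suffices, and phase
estimation to this precision uses `O(log (1 / δ') P₀ / ε)` applications of `W'`, of
`3 (2 μ + 1) = O(P₀ ^ (-1/2))` queries each. As `|δ| ≤ P₀`, this is within the claimed bound. For
`ε > P₀` the precision `r` is capped at a constant, and the assumption `ε ≤ c P₀² / |δ|` pays for the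
queries.

Phase estimation is done in one run with a good window instead of repetitions and a median. For
small `δ'` the window consists of the coefficients of a power of the Dirichlet kernel, whose exponent
is of order `log (1 / δ')` (`exists_window_of_power`). The bound `log (1 / δ')` tends to `0` as `δ'`
tends to `1`; there a short flat window is used, down to length one, when the algorithm guesses and
makes no query at all (`exists_window_of_flat`).
-/

namespace AAE

noncomputable section

/-! ### Reading out a phase by the discrete Fourier transform -/

/-- The inverse quantum Fourier transform on `ℤ / L`, with entries
`L ^ (-1/2) exp (-2 π i b j / L)`. -/
def fourier (L : ℕ) [NeZero L] : Matrix (ZMod L) (ZMod L) ℂ :=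
  Matrix.of fun b j => ((√(L : ℝ))⁻¹ : ℝ) * ZMod.stdAddChar (-(b * j))

theorem fourier_mem_unitaryGroup (L : ℕ) [NeZero L] :
    fourier L ∈ Matrix.unitaryGroup (ZMod L) ℂ := by
  rw [Matrix.mem_unitaryGroup_iff']
  ext j k
  have hL : (0 : ℝ) < L := by exact_mod_cast Nat.pos_of_ne_zero (NeZero.ne L)
  have hs : (((√(L : ℝ))⁻¹ : ℝ) : ℂ) * ((√(L : ℝ))⁻¹ : ℝ) = ((L : ℝ)⁻¹ : ℝ) := by
    rw [← Complex.ofReal_mul, ← mul_inv, Real.mul_self_sqrt hL.le]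
  have hterm : ∀ b : ZMod L, star (fourier L b j) * fourier L b k
      = ((L : ℝ)⁻¹ : ℝ) * ZMod.stdAddChar (b * (j - k)) := by
    intro b
    have h1 : (starRingEnd ℂ) (ZMod.stdAddChar (-(b * j))) = ZMod.stdAddChar (b * j) := by
      rw [← AddChar.map_neg_eq_conj, neg_neg]
    have h2 : (ZMod.stdAddChar (b * (j - k)) : ℂ)
        = ZMod.stdAddChar (b * j) * ZMod.stdAddChar (-(b * k)) := by
      rw [← AddChar.map_add_eq_mul]
      ring_nf
    simp only [fourier, Matrix.of_apply, star_mul', RCLike.star_def, Complex.conj_ofReal, h1, h2,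
      ← hs]
    ring
  rw [Matrix.star_eq_conjTranspose, Matrix.mul_apply]
  simp only [Matrix.conjTranspose_apply, hterm]
  rw [← Finset.mul_sum, AddChar.sum_mulShift _ (ZMod.isPrimitive_stdAddChar L), Matrix.one_apply,
    ZMod.card]
  by_cases h : j = k
  · subst h
    have : (L : ℂ) ≠ 0 := by exact_mod_cast hL.ne'
    simp [this]
  · simp [h, sub_eq_zero]

theorem star_mulVec_dotProduct_mulVec {S : Type} [Fintype S] [DecidableEq S] {U : Matrix S S ℂ}
    (hU : U ∈ Matrix.unitaryGroup S ℂ) (v w : S → ℂ) :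
    star (U *ᵥ v) ⬝ᵥ (U *ᵥ w) = star v ⬝ᵥ w := by
  rw [Matrix.star_mulVec, Matrix.dotProduct_mulVec, Matrix.vecMul_vecMul,
    ← Matrix.star_eq_conjTranspose, Matrix.mem_unitaryGroup_iff'.1 hU, Matrix.vecMul_one]

theorem sum_norm_sq_mulVec_of_mem_unitaryGroup {I : Type} [Fintype I] [DecidableEq I]
    {V : Matrix I I ℂ} (hV : V ∈ Matrix.unitaryGroup I ℂ) (w : I → ℂ) :
    ∑ i, ‖(V *ᵥ w) i‖ ^ 2 = ∑ i, ‖w i‖ ^ 2 := by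
  have key : ∀ u : I → ℂ, star u ⬝ᵥ u = ((∑ i, ‖u i‖ ^ 2 : ℝ) : ℂ) := by
    intro u
    simp [dotProduct, Complex.conj_mul']
  have h := star_mulVec_dotProduct_mulVec hV w w
  rw [key, key] at h
  exact_mod_cast h

/-- Amplitude of the outcome `b` when the phase `x` is read out with the window `α`, that is, when
the state with amplitudes `α j * exp (i j x)` is measured in the Fourier basis. -/
def readout {L : ℕ} [NeZero L] (α : ZMod L → ℂ) (x : ℝ) (b : ZMod L) : ℂ :=
  (fourier L *ᵥ fun j => α j * Complex.exp ((j.val * x : ℝ) * Complex.I)) b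

theorem sum_norm_sq_readout {L : ℕ} [NeZero L] (α : ZMod L → ℂ) (x : ℝ) :
    ∑ b, ‖readout α x b‖ ^ 2 = ∑ j, ‖α j‖ ^ 2 := by
  unfold readout
  rw [sum_norm_sq_mulVec_of_mem_unitaryGroup (fourier_mem_unitaryGroup L)]
  simp only [norm_mul, Complex.norm_exp_ofReal_mul_I, mul_one]

theorem readout_const_mul {L : ℕ} [NeZero L] (c : ℂ) (α : ZMod L → ℂ) (x : ℝ) (b : ZMod L) :
    readout (fun j => c * α j) x b = c * readout α x b := by
  simp only [readout, Matrix.mulVec, dotProduct, Finset.mul_sum]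
  exact Finset.sum_congr rfl fun j _ => by ring

theorem sum_zmod_val {M : Type} [AddCommMonoid M] (L : ℕ) [NeZero L] (f : ℕ → M) :
    ∑ j : ZMod L, f j.val = ∑ j ∈ Finset.range L, f j := by
  cases L with
  | zero => exact absurd rfl (NeZero.ne 0)
  | succ n => exact Fin.sum_univ_eq_sum_range f (n + 1)

/-- The angle `2 π b / L` that the outcome `b` stands for. -/
def angle {L : ℕ} (b : ZMod L) : ℝ := 2 * Real.pi * b.val / L

/-- A window whose entries are the coefficients of a polynomial turns the readout amplitude into a
value of that polynomial on the unit circle. -/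
theorem readout_coeff {L : ℕ} [NeZero L] (P : Polynomial ℂ) (hP : P.natDegree < L) (x : ℝ)
    (b : ZMod L) :
    readout (fun j : ZMod L => P.coeff j.val) x b
      = ((√(L : ℝ))⁻¹ : ℝ) * P.eval (Complex.exp ((x - angle b : ℝ) * Complex.I)) := by
  rw [Polynomial.eval_eq_sum_range' hP, Finset.mul_sum, ← sum_zmod_val L (fun j =>
    (((√(L : ℝ))⁻¹ : ℝ) : ℂ) *
      (P.coeff j * Complex.exp ((x - angle b : ℝ) * Complex.I) ^ j))]
  simp only [readout, Matrix.mulVec, dotProduct, fourier, Matrix.of_apply]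
  refine Finset.sum_congr rfl fun j _ => ?_
  have h1 : (-(b * j) : ZMod L) = ((-(b.val * j.val : ℤ) : ℤ) : ZMod L) := by
    push_cast
    simp
  rw [h1, ZMod.stdAddChar_coe, ← Complex.exp_nat_mul, mul_assoc]
  congr 1
  rw [mul_left_comm, ← Complex.exp_add]
  congr 2
  unfold angle
  push_cast
  ring

/-- The angles `x` and `y` differ by at most `r` modulo `2 π`. -/
def AngleClose (r x y : ℝ) : Prop := ∃ k : ℤ, |x - y - 2 * Real.pi * k| ≤ r

/-! ### Windows that concentrate the readout -/

/-- The geometric polynomial `1 + X + ⋯ + X ^ (K - 1)`, whose values on the unit circle are those of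
the Dirichlet kernel up to a phase. -/
def geomPoly (K : ℕ) : Polynomial ℂ := ∑ i ∈ Finset.range K, Polynomial.X ^ i

theorem eval_geomPoly (K : ℕ) (z : ℂ) : (geomPoly K).eval z = ∑ i ∈ Finset.range K, z ^ i := by
  simp [geomPoly, Polynomial.eval_finsetSum]

theorem coeff_geomPoly (K j : ℕ) : (geomPoly K).coeff j = if j < K then 1 else 0 := by
  simp [geomPoly, Polynomial.coeff_X_pow]

theorem natDegree_geomPoly_le (K : ℕ) : (geomPoly K).natDegree ≤ K - 1 := by
  refine Polynomial.natDegree_sum_le_of_forall_le _ _ fun i hi => ?_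
  rw [Polynomial.natDegree_X_pow]
  have := Finset.mem_range.1 hi
  omega

theorem sum_norm_sq_coeff_geomPoly {L K : ℕ} [NeZero L] (h : K ≤ L) :
    ∑ j : ZMod L, ‖(geomPoly K).coeff j.val‖ ^ 2 = K := by
  rw [sum_zmod_val L (fun j => ‖(geomPoly K).coeff j‖ ^ 2)]
  simp only [coeff_geomPoly]
  rw [← Finset.sum_subset (Finset.range_mono h)]
  · rw [Finset.sum_congr rfl (g := fun _ => (1 : ℝ))]
    · simp
    · intro i hi
      simp [Finset.mem_range.1 hi]
  · intro i _ hi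
    simp [Finset.mem_range.not.1 hi]

/-- Off the `r`-neighbourhood of `0` modulo `2 π`, the Dirichlet kernel is at most `π / r`, whatever
its length. -/
theorem norm_eval_geomPoly_le (K : ℕ) {r x y : ℝ} (hr : 0 < r) (h : ¬ AngleClose r x y) :
    ‖(geomPoly K).eval (Complex.exp ((x - y : ℝ) * Complex.I))‖ ≤ Real.pi / r := by
  have hpi := Real.pi_pos
  obtain ⟨k, hk⟩ : ∃ k : ℤ, |x - y - 2 * Real.pi * k| ≤ Real.pi := by
    refine ⟨round ((x - y) / (2 * Real.pi)), ?_⟩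
    have h1 := abs_sub_round ((x - y) / (2 * Real.pi))
    have h2 : x - y - 2 * Real.pi * round ((x - y) / (2 * Real.pi))
        = 2 * Real.pi * ((x - y) / (2 * Real.pi) - round ((x - y) / (2 * Real.pi))) := by
      field_simp
    rw [h2, abs_mul, abs_of_pos (by positivity : 0 < 2 * Real.pi)]
    nlinarith
  have hlt : r < |x - y - 2 * Real.pi * k| := not_le.1 fun h' => h ⟨k, h'⟩
  set t := x - y - 2 * Real.pi * k with ht
  have hz : Complex.exp ((x - y : ℝ) * Complex.I) = Complex.exp (Complex.I * t) := by
    rw [Complex.exp_eq_exp_iff_exists_int]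
    refine ⟨k, ?_⟩
    rw [ht]
    push_cast
    ring
  have hsin : 2 * r / Real.pi ≤ ‖Complex.exp (Complex.I * t) - 1‖ := by
    rw [Complex.norm_exp_I_mul_ofReal_sub_one, Real.norm_eq_abs, abs_mul, abs_two]
    have h3 : |Real.sin (t / 2)| = Real.sin (|t| / 2) := by
      have h5 : 0 ≤ Real.sin (|t| / 2) :=
        Real.sin_nonneg_of_nonneg_of_le_pi (by positivity) (by linarith)
      rcases abs_cases t with ⟨h4, _⟩ | ⟨h4, _⟩ <;> rw [h4] at h5 ⊢
      · exact abs_of_nonneg h5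
      · rw [neg_div, Real.sin_neg] at h5 ⊢
        exact abs_of_nonpos (by linarith)
    have h4 := Real.mul_le_sin (x := |t| / 2) (by positivity) (by linarith)
    rw [h3]
    have h5 : 2 * r / Real.pi ≤ 2 * (2 / Real.pi * (|t| / 2)) := by
      rw [show 2 * (2 / Real.pi * (|t| / 2)) = 2 * |t| / Real.pi by ring]
      gcongr
    linarith
  have hpos : 0 < 2 * r / Real.pi := by positivity
  have hne : Complex.exp (Complex.I * t) ≠ 1 := fun h' => by
    rw [h', sub_self, norm_zero] at hsin
    linarith
  rw [hz, eval_geomPoly, geom_sum_eq hne, norm_div]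
  have hnum : ‖Complex.exp (Complex.I * t) ^ K - 1‖ ≤ 2 := by
    refine (norm_sub_le _ _).trans ?_
    rw [norm_pow, mul_comm Complex.I, Complex.norm_exp_ofReal_mul_I]
    norm_num
  calc _ ≤ 2 / (2 * r / Real.pi) := by gcongr
    _ = Real.pi / r := by field_simp

/-- Within `1 / K` of `0` modulo `2 π`, the Dirichlet kernel of length `K` is at least `K / 2`. -/
theorem le_norm_eval_geomPoly {K : ℕ} {r x y : ℝ} (hr : r * K ≤ 1) (h : AngleClose r x y) :
    (K : ℝ) / 2 ≤ ‖(geomPoly K).eval (Complex.exp ((x - y : ℝ) * Complex.I))‖ := by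
  obtain ⟨k, hk⟩ := h
  set t := x - y - 2 * Real.pi * k with ht
  have hz : Complex.exp ((x - y : ℝ) * Complex.I) = Complex.exp (t * Complex.I) := by
    rw [Complex.exp_eq_exp_iff_exists_int]
    refine ⟨k, ?_⟩
    rw [ht]
    push_cast
    ring
  refine le_trans ?_ (Complex.re_le_norm _)
  rw [hz, eval_geomPoly, Complex.re_sum]
  have hterm : ∀ i ∈ Finset.range K, (1 / 2 : ℝ) ≤ (Complex.exp (t * Complex.I) ^ i).re := by
    intro i hi
    have h1 : Complex.exp (t * Complex.I) ^ i = Complex.exp ((i * t : ℝ) * Complex.I) := by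
      rw [← Complex.exp_nat_mul]
      push_cast
      ring_nf
    rw [h1, Complex.exp_ofReal_mul_I_re]
    refine le_trans ?_ Real.one_sub_sq_div_two_le_cos
    have hi' : (i : ℝ) ≤ K := by exact_mod_cast (Finset.mem_range.1 hi).le
    have h2 : |(i : ℝ) * t| ≤ 1 := by
      rw [abs_mul, Nat.abs_cast]
      calc (i : ℝ) * |t| ≤ K * r := by gcongr
        _ ≤ 1 := by linarith
    have h3 := (sq_le_one_iff_abs_le_one _).2 h2
    linarith
  have := Finset.sum_le_sum hterm
  simp only [Finset.sum_const, Finset.card_range, nsmul_eq_mul] at this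
  linarith

open Classical in
/-- The probability that the phase `x`, read out with the window `α`, is missed by more than `r`
modulo `2 π`. -/
def missProb {L : ℕ} [NeZero L] (α : ZMod L → ℂ) (r x : ℝ) : ℝ :=
  ∑ b, if AngleClose r x (angle b) then 0 else ‖readout α x b‖ ^ 2

theorem add_two_le_three_pow {n : ℕ} (hn : 1 ≤ n) : (n + 2 : ℝ) ≤ 3 ^ n := by
  induction n, hn using Nat.le_induction with
  | base => norm_num
  | succ m hm ih =>
    rw [pow_succ]
    push_cast
    have : (0 : ℝ) ≤ m := by positivity
    linarith

/-- Window of high confidence. The window of coefficients of the `(n + 1)`-st power of the Dirichlet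
kernel of length `K ≥ 4 π / r` misses the phase by more than `r` with probability at most
`exp (-n)`. -/
theorem exists_window_of_power {r : ℝ} (hr : 0 < r) {n K : ℕ} (hn : 1 ≤ n)
    (hK : 4 * Real.pi / r ≤ K) :
    ∃ α : ZMod ((n + 1) * K + 1) → ℂ, ∑ j, ‖α j‖ ^ 2 = 1 ∧
      ∀ x : ℝ, missProb α r x ≤ Real.exp (-n) := by
  classical
  have hpi := Real.pi_pos
  have hK0 : (0 : ℝ) < K := lt_of_lt_of_le (by positivity) hK
  have hK1 : (1 : ℝ) ≤ K := by
    have : 0 < K := by exact_mod_cast hK0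
    exact_mod_cast this
  set L := (n + 1) * K + 1 with hL
  set D := geomPoly K with hD
  set P := D ^ (n + 1) with hP
  have hPdeg : P.natDegree < L := by
    calc P.natDegree ≤ (n + 1) * D.natDegree := Polynomial.natDegree_pow_le
      _ ≤ (n + 1) * K := by
        gcongr
        exact (natDegree_geomPoly_le K).trans (Nat.sub_le _ _)
      _ < L := Nat.lt_succ_self _
  have hKL : K ≤ L := by
    rw [hL]
    nlinarith
  have hDdeg : D.natDegree < L := by
    have : 0 < K := by exact_mod_cast hK0
    exact (natDegree_geomPoly_le K).trans_lt (by omega)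
  set M : ℝ := ∑ j : ZMod L, ‖P.coeff j.val‖ ^ 2 with hM
  have hL0 : (0 : ℝ) < L := by positivity
  -- The Cauchy-Schwarz inequality bounds the norm of the window below by the value at `1`.
  have hMK : (K : ℝ) ^ (2 * (n + 1)) ≤ L * M := by
    have h1 : P.eval 1 = (K : ℂ) ^ (n + 1) := by
      simp [hP, hD, eval_geomPoly]
    have h2 : (K : ℝ) ^ (n + 1) ≤ ∑ j : ZMod L, ‖P.coeff j.val‖ := by
      calc (K : ℝ) ^ (n + 1) = ‖P.eval 1‖ := by rw [h1]; simp
        _ = ‖∑ j : ZMod L, P.coeff j.val‖ := by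
          rw [Polynomial.eval_eq_sum_range' hPdeg, sum_zmod_val L (fun j => P.coeff j)]
          simp
        _ ≤ _ := norm_sum_le _ _
    have h3 := sq_sum_le_card_mul_sum_sq (s := (Finset.univ : Finset (ZMod L)))
      (f := fun j => ‖P.coeff j.val‖)
    rw [Finset.card_univ, ZMod.card] at h3
    calc (K : ℝ) ^ (2 * (n + 1)) = ((K : ℝ) ^ (n + 1)) ^ 2 := by rw [← pow_mul, mul_comm]
      _ ≤ (∑ j : ZMod L, ‖P.coeff j.val‖) ^ 2 := by gcongr
      _ ≤ L * M := h3
  have hM0 : 0 < M := by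
    have : 0 < L * M := lt_of_lt_of_le (by positivity) hMK
    exact (mul_pos_iff_of_pos_left hL0).1 this
  refine ⟨fun j => (((√M)⁻¹ : ℝ) : ℂ) * P.coeff j.val, ?_, fun x => ?_⟩
  · simp only [norm_mul, mul_pow, ← Finset.mul_sum, Complex.norm_real, Real.norm_eq_abs, sq_abs,
      inv_pow, Real.sq_sqrt hM0.le]
    exact inv_mul_cancel₀ hM0.ne'
  -- On missed outcomes all but one factor of the power is bounded by its supremum there; the last
  -- one is summed by Parseval's identity, so that no factor of the order of `K` is lost.
  have hterm : ∀ b : ZMod L,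
      (if AngleClose r x (angle b) then 0 else
        ‖readout (fun j : ZMod L => (((√M)⁻¹ : ℝ) : ℂ) * P.coeff j.val) x b‖ ^ 2)
      ≤ M⁻¹ * (Real.pi / r) ^ (2 * n) * ‖readout (fun j : ZMod L => D.coeff j.val) x b‖ ^ 2 := by
    intro b
    split_ifs with h
    · positivity
    have h1 := norm_eval_geomPoly_le K hr h
    rw [readout_const_mul, readout_coeff P hPdeg, readout_coeff D hDdeg, hP, Polynomial.eval_pow]
    set d := D.eval (Complex.exp ((x - angle b : ℝ) * Complex.I)) with hd
    have h2 : ‖d‖ ^ (2 * n) ≤ (Real.pi / r) ^ (2 * n) := by gcongr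
    have h3 : ‖(((√M)⁻¹ : ℝ) : ℂ) * ((((√(L : ℝ))⁻¹ : ℝ) : ℂ) * d ^ (n + 1))‖ ^ 2
        = M⁻¹ * ‖d‖ ^ (2 * n) * ‖(((√(L : ℝ))⁻¹ : ℝ) : ℂ) * d‖ ^ 2 := by
      simp only [norm_mul, norm_pow, mul_pow, Complex.norm_real, Real.norm_eq_abs, sq_abs,
        inv_pow, Real.sq_sqrt hM0.le]
      ring
    rw [h3]
    gcongr
  have hnum := add_two_le_three_pow hn
  have hratio : (Real.pi / r) ^ (2 * n) ≤ (1 / 16 : ℝ) ^ n * (K : ℝ) ^ (2 * n) := by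
    have h1 : Real.pi / r ≤ K / 4 := by
      rw [mul_div_assoc] at hK
      linarith
    calc (Real.pi / r) ^ (2 * n) ≤ ((K : ℝ) / 4) ^ (2 * n) := by gcongr
      _ = (1 / 16 : ℝ) ^ n * (K : ℝ) ^ (2 * n) := by
        rw [pow_mul, pow_mul, ← mul_pow]
        ring_nf
  have hexp : (3 / 16 : ℝ) ≤ Real.exp (-1) := by
    have h1 := Real.exp_one_lt_d9
    rw [Real.exp_neg, le_inv_comm₀ (by norm_num) (Real.exp_pos 1)]
    linarith
  have hLK : (L : ℝ) ≤ (n + 2) * K := by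
    rw [hL]
    push_cast
    linarith
  calc missProb _ r x
      ≤ ∑ b, M⁻¹ * (Real.pi / r) ^ (2 * n)
          * ‖readout (fun j : ZMod L => D.coeff j.val) x b‖ ^ 2 :=
        Finset.sum_le_sum fun b _ => hterm b
    _ = M⁻¹ * (Real.pi / r) ^ (2 * n) * K := by
        rw [← Finset.mul_sum, sum_norm_sq_readout, sum_norm_sq_coeff_geomPoly hKL]
    _ ≤ M⁻¹ * ((1 / 16 : ℝ) ^ n * (K : ℝ) ^ (2 * n)) * K := by gcongr
    _ = M⁻¹ * ((1 / 16 : ℝ) ^ n * ((K : ℝ) ^ (2 * (n + 1)) / K)) := by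
        field_simp
        ring
    _ ≤ M⁻¹ * ((1 / 16 : ℝ) ^ n * ((((n + 2) * K) * M) / K)) := by
        gcongr
        exact hMK.trans (by gcongr)
    _ = (n + 2) * (1 / 16 : ℝ) ^ n := by field_simp
    _ ≤ 3 ^ n * (1 / 16 : ℝ) ^ n := by gcongr
    _ = (3 / 16 : ℝ) ^ n := by rw [← mul_pow]; norm_num
    _ ≤ Real.exp (-1) ^ n := by gcongr
    _ = Real.exp (-n) := by rw [← Real.exp_nat_mul]; ring_nf

/-- On the grid of the `L` outcomes at least `⌊r L / π⌋` angles are within `r` of a given one. -/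
theorem floor_le_card_angleClose {L : ℕ} [NeZero L] {r : ℝ} (hr : 0 ≤ r) (hr' : r ≤ 1 / 2) (x : ℝ)
    (s : Finset (ZMod L)) (hs : ∀ b, AngleClose r x (angle b) → b ∈ s) :
    ⌊r * L / Real.pi⌋₊ ≤ s.card := by
  classical
  have hpi := Real.pi_pos
  have hL : (0 : ℝ) < L := by exact_mod_cast Nat.pos_of_ne_zero (NeZero.ne L)
  set T := ⌊r * L / Real.pi⌋₊ with hT
  have hTle : (T : ℝ) ≤ r * L / Real.pi := Nat.floor_le (by positivity)
  have hTL : (T : ℝ) < L := by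
    refine hTle.trans_lt ?_
    rw [div_lt_iff₀ hpi]
    nlinarith [Real.pi_gt_three]
  set n₀ : ℤ := ⌈(x - r) * L / (2 * Real.pi)⌉ with hn
  have hn1 : (x - r) * L / (2 * Real.pi) ≤ n₀ := Int.le_ceil _
  have hn2 : (n₀ : ℝ) < (x - r) * L / (2 * Real.pi) + 1 := Int.ceil_lt_add_one _
  have hinj : Set.InjOn (fun i : ℕ => ((n₀ + i : ℤ) : ZMod L)) (Finset.range T) := by
    intro i hi j hj hij
    simp only [Finset.coe_range, Set.mem_Iio] at hi hj
    have hTL' : T < L := by exact_mod_cast hTL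
    simp only [Int.cast_add, Int.cast_natCast, add_right_inj] at hij
    rw [ZMod.natCast_eq_natCast_iff'] at hij
    rwa [Nat.mod_eq_of_lt (hi.trans hTL'), Nat.mod_eq_of_lt (hj.trans hTL')] at hij
  rw [← Finset.card_range T, ← Finset.card_image_of_injOn hinj]
  refine Finset.card_le_card fun b hb => hs b ?_
  obtain ⟨i, hi, rfl⟩ := Finset.mem_image.1 hb
  have hi' : (i : ℝ) ≤ T - 1 := by
    have : i + 1 ≤ T := Finset.mem_range.1 hi
    have : ((i + 1 : ℕ) : ℝ) ≤ T := by exact_mod_cast this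
    push_cast at this
    linarith
  have hi0 : (0 : ℝ) ≤ i := by positivity
  set z : ℤ := n₀ + i with hz
  have hval : (((z : ZMod L).val : ℤ) : ℝ) = z - L * (z / L : ℤ) := by
    rw [ZMod.val_intCast, Int.emod_def]
    push_cast
    ring
  have hval' : (((z : ZMod L).val : ℕ) : ℝ) = z - L * (z / L : ℤ) := by
    rw [← hval]
    norm_cast
  refine ⟨(z / L : ℤ), ?_⟩
  have hang : x - angle (z : ZMod L) - 2 * Real.pi * (z / L : ℤ) = x - 2 * Real.pi * z / L := by
    rw [angle, hval']
    field_simp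
    ring
  rw [hang]
  have hzr : (z : ℝ) = n₀ + i := by rw [hz]; push_cast; ring
  have e1 : 2 * Real.pi * z / L = x + (z - x * L / (2 * Real.pi)) * (2 * Real.pi / L) := by
    field_simp
    ring
  have e2 : (x - r) * L / (2 * Real.pi) = x * L / (2 * Real.pi) - r * L / (2 * Real.pi) := by ring
  have e3 : r * L / Real.pi = 2 * (r * L / (2 * Real.pi)) := by field_simp
  have e4 : |(z : ℝ) - x * L / (2 * Real.pi)| ≤ r * L / (2 * Real.pi) := by
    rw [abs_le]
    constructor <;> rw [hzr] <;> linarith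
  rw [e1, show x - (x + (z - x * L / (2 * Real.pi)) * (2 * Real.pi / L))
    = -((z - x * L / (2 * Real.pi)) * (2 * Real.pi / L)) by ring, abs_neg, abs_mul,
    abs_of_pos (by positivity : 0 < 2 * Real.pi / L)]
  calc _ ≤ r * L / (2 * Real.pi) * (2 * Real.pi / L) := by gcongr
    _ = r := by field_simp

/-- Window of low confidence. A flat window of length `K ≤ 1 / r`, read out on a fine enough grid,
finds the phase up to `r` with probability at least `r K / (8 π)`. For `K = 1` this is guessing. -/
theorem exists_window_of_flat {r : ℝ} (hr : 0 < r) (hr' : r ≤ 1 / 2) {L K : ℕ} [NeZero L]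
    (hK : 1 ≤ K) (hKL : K ≤ L) (hL : 2 * Real.pi / r ≤ L) (hrK : r * K ≤ 1) :
    ∃ α : ZMod L → ℂ, (∀ j, K - 1 < j.val → α j = 0) ∧ ∑ j, ‖α j‖ ^ 2 = 1 ∧
      ∀ x : ℝ, missProb α r x ≤ 1 - r * K / (8 * Real.pi) := by
  classical
  have hpi := Real.pi_pos
  have hK0 : (0 : ℝ) < K := by exact_mod_cast hK
  have hL0 : (0 : ℝ) < L := by exact_mod_cast Nat.pos_of_ne_zero (NeZero.ne L)
  have hdeg : (geomPoly K).natDegree < L := by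
    have := natDegree_geomPoly_le K
    omega
  set α : ZMod L → ℂ := fun j => (((√(K : ℝ))⁻¹ : ℝ) : ℂ) * (geomPoly K).coeff j.val with hα
  have hnorm : ∑ j, ‖α j‖ ^ 2 = 1 := by
    simp only [hα, norm_mul, mul_pow, ← Finset.mul_sum, sum_norm_sq_coeff_geomPoly hKL,
      Complex.norm_real, Real.norm_eq_abs, sq_abs, inv_pow, Real.sq_sqrt hK0.le]
    exact inv_mul_cancel₀ hK0.ne'
  refine ⟨α, fun j hj => ?_, hnorm, fun x => ?_⟩
  · simp only [hα, coeff_geomPoly]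
    rw [if_neg (by omega), mul_zero]
  set s : Finset (ZMod L) := Finset.univ.filter fun b => AngleClose r x (angle b) with hs
  have hcard : r * L / (2 * Real.pi) ≤ s.card := by
    have h1 := floor_le_card_angleClose hr.le hr' x s fun b hb => by simp [hs, hb]
    have h2 := Nat.lt_floor_add_one (r * L / Real.pi)
    have h3 : ((⌊r * L / Real.pi⌋₊ : ℕ) : ℝ) ≤ s.card := by exact_mod_cast h1
    have h4 : 1 ≤ r * L / (2 * Real.pi) := by
      rw [le_div_iff₀ (by positivity)]
      rw [div_le_iff₀ hr] at hL
      linarith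
    have h5 : r * L / Real.pi = 2 * (r * L / (2 * Real.pi)) := by field_simp
    linarith
  have hhit : ∀ b ∈ s, (K : ℝ) / (4 * L) ≤ ‖readout α x b‖ ^ 2 := by
    intro b hb
    have h1 := le_norm_eval_geomPoly hrK (Finset.mem_filter.1 hb).2
    rw [hα, readout_const_mul, readout_coeff _ hdeg]
    simp only [norm_mul, mul_pow, Complex.norm_real, Real.norm_eq_abs, sq_abs, inv_pow,
      Real.sq_sqrt hK0.le, Real.sq_sqrt hL0.le]
    calc (K : ℝ) / (4 * L) = (K : ℝ)⁻¹ * ((L : ℝ)⁻¹ * (K / 2) ^ 2) := by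
          field_simp
          norm_num
      _ ≤ _ := by gcongr
  have hsum : missProb α r x + ∑ b ∈ s, ‖readout α x b‖ ^ 2 = 1 := by
    rw [← hnorm, ← sum_norm_sq_readout α x, missProb, hs, Finset.sum_filter,
      ← Finset.sum_add_distrib]
    refine Finset.sum_congr rfl fun b _ => ?_
    split_ifs <;> simp
  have hge : r * K / (8 * Real.pi) ≤ ∑ b ∈ s, ‖readout α x b‖ ^ 2 := by
    calc r * K / (8 * Real.pi) = r * L / (2 * Real.pi) * (K / (4 * L)) := by
          field_simp
          norm_num
      _ ≤ s.card * ((K : ℝ) / (4 * L)) := by gcongr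
      _ = ∑ b ∈ s, (K : ℝ) / (4 * L) := by rw [Finset.sum_const, nsmul_eq_mul]
      _ ≤ _ := Finset.sum_le_sum hhit
  linarith

/-- Phase estimation to precision `r` with failure probability `δ'` needs `O(log (1 / δ') / r)`
powers of the unitary, uniformly in `δ' < 1`: the count tends to `0` as `δ'` tends to `1`. -/
theorem exists_window {r δ' : ℝ} (hr : 0 < r) (hr' : r ≤ 1 / 2) (hδ : 0 < δ') (hδ' : δ' < 1) :
    ∃ (L : ℕ) (_ : NeZero L) (N : ℕ) (α : ZMod L → ℂ), (N : ℝ) ≤ 2000 * Real.log (1 / δ') / r ∧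
      (∀ j, N < j.val → α j = 0) ∧ ∑ j, ‖α j‖ ^ 2 = 1 ∧ ∀ x : ℝ, missProb α r x ≤ δ' := by
  have hpi := Real.pi_pos
  have hpi' : Real.pi < 3.15 := Real.pi_lt_d2
  have hlog : 1 - δ' ≤ Real.log (1 / δ') := by
    have := Real.one_sub_inv_le_log_of_pos (x := 1 / δ') (by positivity)
    simpa using this
  -- Below the threshold `log (1 / δ')` is bounded away from `0`, so that rounding up costs only a
  -- constant factor; above it, the flat window of length about `8 π (1 - δ') / r` is at
  -- most `1 / r` long.
  rcases le_or_gt δ' (63 / 64) with h | h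
  · set n := ⌈Real.log (1 / δ')⌉₊ with hn
    set K := ⌈4 * Real.pi / r⌉₊ with hK
    have hl0 : 0 < Real.log (1 / δ') := by linarith
    obtain ⟨α, h1, h2⟩ := exists_window_of_power (n := n) (K := K) hr (Nat.one_le_ceil_iff.2 hl0)
      (Nat.le_ceil _)
    refine ⟨(n + 1) * K + 1, inferInstance, (n + 1) * K, α, ?_, fun j hj => ?_, h1, fun x => ?_⟩
    · have hn1 : (n : ℝ) < Real.log (1 / δ') + 1 := Nat.ceil_lt_add_one hl0.le
      have hK1 : (K : ℝ) < 4 * Real.pi / r + 1 := Nat.ceil_lt_add_one (by positivity)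
      have hK2 : (K : ℝ) ≤ 14 / r := by
        rw [le_div_iff₀ hr]
        have : (K : ℝ) * r ≤ (4 * Real.pi / r + 1) * r := by gcongr
        have e : (4 * Real.pi / r + 1) * r = 4 * Real.pi + r := by field_simp
        linarith
      have hn2 : (n : ℝ) + 1 ≤ 129 * Real.log (1 / δ') := by linarith
      push_cast
      calc ((n : ℝ) + 1) * K ≤ (129 * Real.log (1 / δ')) * (14 / r) := by gcongr
        _ = 1806 * Real.log (1 / δ') / r := by ring
        _ ≤ 2000 * Real.log (1 / δ') / r := by gcongr; norm_num
    · have := j.val_lt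
      omega
    · refine (h2 x).trans ?_
      have : Real.log (1 / δ') ≤ n := Nat.le_ceil _
      rw [one_div, Real.log_inv] at this
      calc Real.exp (-n) ≤ Real.exp (Real.log δ') := Real.exp_le_exp.2 (by linarith)
        _ = δ' := Real.exp_log hδ
  · set K := ⌈8 * Real.pi * (1 - δ') / r⌉₊ with hK
    have hη : 0 < 1 - δ' := by linarith
    have hK1 : 1 ≤ K := Nat.one_le_ceil_iff.2 (by positivity)
    have hK2 : (K : ℝ) < 8 * Real.pi * (1 - δ') / r + 1 := Nat.ceil_lt_add_one (by positivity)
    have hK3 : 8 * Real.pi * (1 - δ') / r ≤ K := Nat.le_ceil _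
    have hL0 : NeZero (K + ⌈2 * Real.pi / r⌉₊) := ⟨by omega⟩
    have hrK : r * K ≤ 1 := by
      have h1 : r * K ≤ r * (8 * Real.pi * (1 - δ') / r + 1) := by gcongr
      have e : r * (8 * Real.pi * (1 - δ') / r + 1) = 8 * Real.pi * (1 - δ') + r := by field_simp
      nlinarith
    obtain ⟨α, h1, h2, h3⟩ := exists_window_of_flat (L := K + ⌈2 * Real.pi / r⌉₊) hr hr' hK1
      (Nat.le_add_right _ _) (by push_cast; linarith [Nat.le_ceil (2 * Real.pi / r)]) hrK
    refine ⟨K + ⌈2 * Real.pi / r⌉₊, hL0, K - 1, α, ?_, h1, h2, fun x => (h3 x).trans ?_⟩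
    · rw [Nat.cast_sub hK1, Nat.cast_one]
      calc (K : ℝ) - 1 ≤ 8 * Real.pi * (1 - δ') / r := by linarith
        _ ≤ 2000 * Real.log (1 / δ') / r := by
          gcongr
          nlinarith
    · rw [div_le_iff₀ hr] at hK3
      have : 1 - δ' ≤ r * K / (8 * Real.pi) := by
        rw [le_div_iff₀ (by positivity)]
        linarith
      linarith

/-! ### The operators performed by the circuits -/

section Circuits

variable {S A : Type} [Fintype S] [DecidableEq S] [Fintype A] [DecidableEq A]

theorem controlled_mul (c : A → Bool) (U V : Matrix S S ℂ) :
    controlled c (U * V) = controlled c U * controlled c V := by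
  rw [controlled, controlled, controlled, ← Matrix.blockDiagonal_mul]
  congr 1
  funext a
  by_cases h : c a <;> simp [h]

theorem controlled_one {S A : Type} [DecidableEq S] [DecidableEq A] (c : A → Bool) :
    controlled c (1 : Matrix S S ℂ) = 1 := by
  rw [controlled, ← Matrix.blockDiagonal_one]
  congr 1
  funext a
  simp

theorem controlled_mulVec (c : A → Bool) (U : Matrix S S ℂ) (v : S × A → ℂ) (s : S) (a : A) :
    (controlled c U *ᵥ v) (s, a) = if c a then (U *ᵥ fun s' => v (s', a)) s else v (s, a) := by
  simp only [Matrix.mulVec, dotProduct, controlled, Fintype.sum_prod_type,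
    Matrix.blockDiagonal_apply, ite_mul, zero_mul, Finset.sum_ite_eq, Finset.mem_univ, if_true]
  by_cases h : c a <;> simp [h, Matrix.one_apply]

theorem ancillaGate_mulVec {S A : Type} [Fintype S] [DecidableEq S] [Fintype A]
    (V : Matrix A A ℂ) (v : S × A → ℂ) (s : S) (a : A) :
    (((1 : Matrix S S ℂ) ⊗ₖ V) *ᵥ v) (s, a) = (V *ᵥ fun a' => v (s, a')) a := by
  simp [Matrix.mulVec, dotProduct, Fintype.sum_prod_type, Matrix.kroneckerMap_apply,
    Matrix.one_apply, ite_mul, Finset.sum_ite_eq]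

theorem Circuit.run_append (O R : Matrix S S ℂ) (C₁ C₂ : Circuit S A) (v : S × A → ℂ) :
    Circuit.run O R (C₁ ++ C₂) v = Circuit.run O R C₂ (Circuit.run O R C₁ v) :=
  List.foldl_append

theorem Circuit.queries_append (C₁ C₂ : Circuit S A) :
    Circuit.queries (C₁ ++ C₂) = Circuit.queries C₁ + Circuit.queries C₂ := by
  simp [Circuit.queries]

theorem Circuit.queries_flatten_replicate (n : ℕ) (C : Circuit S A) :
    Circuit.queries (List.replicate n C).flatten = n * Circuit.queries C := by
  induction n with
  | zero => simp [Circuit.queries]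
  | succ n ih =>
    rw [List.replicate_succ, List.flatten_cons, Circuit.queries_append, ih]
    ring

theorem Circuit.run_flatten_replicate {O R : Matrix S S ℂ} {C : Circuit S A} {c : A → Bool}
    {U : Matrix S S ℂ} (h : ∀ v, Circuit.run O R C v = controlled c U *ᵥ v) (n : ℕ)
    (v : S × A → ℂ) :
    Circuit.run O R (List.replicate n C).flatten v = controlled c (U ^ n) *ᵥ v := by
  induction n generalizing v with
  | zero => simp [Circuit.run, controlled_one]
  | succ n ih =>
    rw [List.replicate_succ, List.flatten_cons, Circuit.run_append, h, ih, pow_succ,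
      controlled_mul, Matrix.mulVec_mulVec]

/-- The reflection `O (-(1 - 2 |s₀⟩⟨s₀|)) Oᴴ = 2 |ψ⟩⟨ψ| - 1` about the prepared state. -/
def stateReflection (s₀ : S) (O : Matrix S S ℂ) : Matrix S S ℂ := O * zeroReflection s₀ * Oᴴ

/-- The walk operator `W = (2 |ψ⟩⟨ψ| - 1) R`. -/
def walk (s₀ : S) (O R : Matrix S S ℂ) : Matrix S S ℂ := stateReflection s₀ O * R

theorem run_walkCircuit (s₀ : S) (O R : Matrix S S ℂ) (c : A → Bool) (v : S × A → ℂ) :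
    Circuit.run O R (walkCircuit s₀ c) v = controlled c (walk s₀ O R) *ᵥ v := by
  simp [Circuit.run, walkCircuit, zeroGate, Gate.toMatrix, walk, stateReflection, controlled_mul,
    mul_assoc]

theorem run_walkInvCircuit (s₀ : S) (O R : Matrix S S ℂ) (c : A → Bool) (v : S × A → ℂ) :
    Circuit.run O R (walkInvCircuit s₀ c) v
      = controlled c (R * stateReflection s₀ O) *ᵥ v := by
  simp [Circuit.run, walkInvCircuit, zeroGate, Gate.toMatrix, stateReflection, controlled_mul,
    mul_assoc]

/-- The amplified walk operator is the odd power `W ^ (2 μ + 1)` of the walk operator: with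
`W = S R` one has `(S R) ^ μ S (R S) ^ μ R = (S R) ^ μ (S R) ^ μ S R`. -/
theorem run_amplifiedWalkCircuit (s₀ : S) (μ : ℕ) (O R : Matrix S S ℂ) (c : A → Bool)
    (v : S × A → ℂ) :
    Circuit.run O R (amplifiedWalkCircuit s₀ μ c) v
      = controlled c (walk s₀ O R ^ (2 * μ + 1)) *ᵥ v := by
  have hmid : ∀ w, Circuit.run O R ([.prepInv c, zeroGate s₀ c, .prep c] : Circuit S A) w
      = controlled c (stateReflection s₀ O) *ᵥ w := by
    intro w
    simp [Circuit.run, zeroGate, Gate.toMatrix, stateReflection, controlled_mul, mul_assoc]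
  have hrefl : Circuit.run O R ([.refl c] : Circuit S A) v = controlled c R *ᵥ v := by
    simp [Circuit.run, Gate.toMatrix]
  have hpow : walk s₀ O R ^ (2 * μ + 1) = walk s₀ O R ^ μ * (stateReflection s₀ O
      * ((R * stateReflection s₀ O) ^ μ * R)) := by
    rw [← mul_assoc (stateReflection s₀ O), ← mul_pow_mul, two_mul, pow_succ, pow_add]
    simp only [walk, mul_assoc]
  rw [amplifiedWalkCircuit, Circuit.run_append, Circuit.run_append, Circuit.run_append, hrefl,
    Circuit.run_flatten_replicate (run_walkInvCircuit s₀ O R c), hmid,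
    Circuit.run_flatten_replicate (run_walkCircuit s₀ O R c), hpow]
  simp only [controlled_mul, Matrix.mulVec_mulVec]

theorem queries_amplifiedWalkCircuit (s₀ : S) (μ : ℕ) (c : A → Bool) :
    (amplifiedWalkCircuit s₀ μ c).queries = 3 * (2 * μ + 1) := by
  rw [amplifiedWalkCircuit, Circuit.queries_append, Circuit.queries_append, Circuit.queries_append,
    Circuit.queries_flatten_replicate, Circuit.queries_flatten_replicate]
  simp only [Circuit.queries, walkInvCircuit, walkCircuit, zeroGate, List.map_cons, List.map_nil,
    Gate.queries, List.sum_cons, List.sum_nil]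
  ring

end Circuits

/-! ### The rotation performed by the walk operator -/

section Rotation

variable {S : Type} [Fintype S] [DecidableEq S]

/-- If `U² ψ = 2 cos y U ψ - ψ`, the Gram matrix of the orbit of `ψ` is that of an equal
superposition of two eigenvectors with phases `± y`. -/
theorem star_pow_mulVec_dotProduct {U : Matrix S S ℂ} (hU : U ∈ Matrix.unitaryGroup S ℂ)
    {ψ : S → ℂ} {y : ℝ} (h0 : star ψ ⬝ᵥ ψ = 1) (h1 : star ψ ⬝ᵥ (U *ᵥ ψ) = (Real.cos y : ℂ))
    (h2 : U *ᵥ (U *ᵥ ψ) = (2 * Real.cos y : ℂ) • (U *ᵥ ψ) - ψ) (j k : ℕ) :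
    star (U ^ j *ᵥ ψ) ⬝ᵥ (U ^ k *ᵥ ψ) = (Real.cos ((k - j : ℝ) * y) : ℂ) := by
  have hchain : ∀ n : ℕ, star ψ ⬝ᵥ (U ^ n *ᵥ ψ) = (Real.cos (n * y) : ℂ) ∧
      star ψ ⬝ᵥ (U ^ (n + 1) *ᵥ ψ) = (Real.cos ((n + 1 : ℕ) * y) : ℂ) := by
    intro n
    induction n with
    | zero => 
      refine ⟨by simpa using h0, ?_⟩
      simpa only [zero_add, pow_one, Nat.cast_one, one_mul] using h1
    | succ n ih =>
      refine ⟨ih.2, ?_⟩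
      have e : U ^ (n + 1 + 1) *ᵥ ψ
          = (2 * Real.cos y : ℂ) • (U ^ (n + 1) *ᵥ ψ) - U ^ n *ᵥ ψ := by
        rw [pow_succ, pow_succ, ← Matrix.mulVec_mulVec, ← Matrix.mulVec_mulVec, h2,
          Matrix.mulVec_sub, Matrix.mulVec_smul, Matrix.mulVec_mulVec]
      rw [e, dotProduct_sub, dotProduct_smul, ih.1, ih.2, smul_eq_mul]
      norm_cast
      have a1 : ((n + 1 + 1 : ℕ) : ℝ) * y = ((n + 1 : ℕ) : ℝ) * y + y := by push_cast; ring
      have a2 : (n : ℝ) * y = ((n + 1 : ℕ) : ℝ) * y - y := by push_cast; ring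
      rw [a1, a2, Real.cos_add, Real.cos_sub]
      ring
  have hle : ∀ j k : ℕ, j ≤ k →
      star (U ^ j *ᵥ ψ) ⬝ᵥ (U ^ k *ᵥ ψ) = (Real.cos ((k - j : ℝ) * y) : ℂ) := by
    intro j k hjk
    obtain ⟨d, rfl⟩ := Nat.exists_eq_add_of_le hjk
    rw [pow_add, ← Matrix.mulVec_mulVec, star_mulVec_dotProduct_mulVec (pow_mem hU j),
      (hchain d).1]
    push_cast
    ring_nf
  rcases le_total j k with h | h
  · exact hle j k h
  · have h3 := congrArg star (hle k j h)
    rw [← Matrix.star_dotProduct_star, star_star, RCLike.star_def,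
      Complex.conj_ofReal, ← Real.cos_neg] at h3
    rw [h3]
    ring_nf

theorem star_ket_dotProduct_ket (s₀ : S) : star (ket s₀) ⬝ᵥ ket s₀ = 1 := by
  simp [ket]

theorem star_dotProduct_mulVec_ket {O : Matrix S S ℂ} (hO : O ∈ Matrix.unitaryGroup S ℂ) (s₀ : S) :
    star (O *ᵥ ket s₀) ⬝ᵥ (O *ᵥ ket s₀) = 1 := by
  rw [star_mulVec_dotProduct_mulVec hO, star_ket_dotProduct_ket]

theorem stateReflection_mulVec {O : Matrix S S ℂ} (hO : O ∈ Matrix.unitaryGroup S ℂ) (s₀ : S)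
    (v : S → ℂ) :
    stateReflection s₀ O *ᵥ v = (2 * (star (O *ᵥ ket s₀) ⬝ᵥ v)) • (O *ᵥ ket s₀) - v := by
  have h1 : O *ᵥ (Oᴴ *ᵥ v) = v := by
    rw [Matrix.mulVec_mulVec, ← Matrix.star_eq_conjTranspose, Matrix.mem_unitaryGroup_iff.1 hO,
      Matrix.one_mulVec]
  have h2 : star (ket s₀) ⬝ᵥ (Oᴴ *ᵥ v) = star (O *ᵥ ket s₀) ⬝ᵥ v := by
    rw [Matrix.star_mulVec, Matrix.dotProduct_mulVec]
  rw [stateReflection, ← Matrix.mulVec_mulVec, ← Matrix.mulVec_mulVec, zeroReflection,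
    Matrix.neg_mulVec, Matrix.sub_mulVec, Matrix.one_mulVec, Matrix.smul_mulVec,
    Matrix.vecMulVec_mulVec, h2, neg_sub, Matrix.mulVec_sub, h1]
  simp [Matrix.mulVec_smul, smul_smul]

/-- The walk operator rotates the prepared state `ψ` by the angle `y` with `cos y = 1 - 2 p`, where
`p = ⟨ψ|Π|ψ⟩`, in the sense that `W ^ j ψ` and `W ^ k ψ` have inner product `cos ((k - j) y)`. -/
theorem star_walk_pow_mulVec_dotProduct {s₀ : S} {O R Proj : Matrix S S ℂ} {p y : ℝ}
    (hO : O ∈ Matrix.unitaryGroup S ℂ) (hProj : IsStarProjection Proj)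
    (hR : Proj = (1 / 2 : ℂ) • (1 - R))
    (hp : star (O *ᵥ ket s₀) ⬝ᵥ Proj *ᵥ (O *ᵥ ket s₀) = (p : ℂ)) (hy : Real.cos y = 1 - 2 * p)
    (j k : ℕ) :
    star (walk s₀ O R ^ j *ᵥ (O *ᵥ ket s₀)) ⬝ᵥ (walk s₀ O R ^ k *ᵥ (O *ᵥ ket s₀))
      = (Real.cos ((k - j : ℝ) * y) : ℂ) := by
  have hR' : R = 1 - (2 : ℂ) • Proj := by
    rw [hR, smul_smul]
    norm_num
  have hRR : R * R = 1 := by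
    have h := hProj.isIdempotentElem.eq
    rw [hR']
    simp only [sub_mul, mul_sub, one_mul, mul_one, Matrix.smul_mul, Matrix.mul_smul, h, smul_smul]
    module
  have hRstar : star R = R := by
    have h := hProj.isSelfAdjoint.star_eq
    rw [hR', star_sub, star_one, star_smul, h]
    simp
  have hRu : R ∈ Matrix.unitaryGroup S ℂ := by
    rw [Matrix.mem_unitaryGroup_iff, hRstar, hRR]
  have hS : stateReflection s₀ O ∈ Matrix.unitaryGroup S ℂ :=
    mul_mem (mul_mem hO (zeroReflection_mem_unitaryGroup s₀)) (Unitary.star_mem hO)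
  set ψ := O *ᵥ ket s₀ with hψ
  have h0 : star ψ ⬝ᵥ ψ = 1 := star_dotProduct_mulVec_ket hO s₀
  have hRψ : R *ᵥ (R *ᵥ ψ) = ψ := by
    rw [show R *ᵥ (R *ᵥ ψ) = (R * R) *ᵥ ψ from Matrix.mulVec_mulVec _ _ _, hRR,
      Matrix.one_mulVec]
  have hassoc : ∀ v, walk s₀ O R *ᵥ v = stateReflection s₀ O *ᵥ (R *ᵥ v) := fun v =>
    (Matrix.mulVec_mulVec _ _ _).symm
  have hφ : star ψ ⬝ᵥ (R *ᵥ ψ) = (Real.cos y : ℂ) := by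
    rw [hR', Matrix.sub_mulVec, Matrix.one_mulVec, Matrix.smul_mulVec, dotProduct_sub,
      dotProduct_smul, h0, hp, hy]
    push_cast
    simp
  have hWψ : walk s₀ O R *ᵥ ψ = (2 * Real.cos y : ℂ) • ψ - R *ᵥ ψ := by
    rw [hassoc, stateReflection_mulVec hO, ← hψ, hφ]
  have hSψ : stateReflection s₀ O *ᵥ ψ = ψ := by
    rw [stateReflection_mulVec hO, ← hψ, h0]
    module
  have hW1 : star ψ ⬝ᵥ (walk s₀ O R *ᵥ ψ) = (Real.cos y : ℂ) := by
    rw [hWψ, dotProduct_sub, dotProduct_smul, h0, hφ, smul_eq_mul]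
    ring
  have hW2 : walk s₀ O R *ᵥ (walk s₀ O R *ᵥ ψ)
      = (2 * Real.cos y : ℂ) • (walk s₀ O R *ᵥ ψ) - ψ := by
    have e : R *ᵥ (walk s₀ O R *ᵥ ψ) = (2 * Real.cos y : ℂ) • (R *ᵥ ψ) - ψ := by
      rw [hWψ, Matrix.mulVec_sub, Matrix.mulVec_smul, hRψ]
    rw [hassoc (walk s₀ O R *ᵥ ψ), e, Matrix.mulVec_sub, Matrix.mulVec_smul, hSψ, ← hassoc]
  exact star_pow_mulVec_dotProduct (mul_mem hS hRu) h0 hW1 hW2 j k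

/-- If the vectors `w i` have inner products `cos ((n j - n i) x)`, the squared norm of a
superposition of them is the mean, over the two signs of `x`, of its value with each `w i` replaced by
the phase of angle `n i * x`. Vectors with coefficient `0` need not be considered. -/
theorem sum_norm_sq_sum_mul_of_cos {S I : Type} [Fintype S] [Fintype I] (β : I → ℂ)
    (w : I → S → ℂ) (n : I → ℝ) (x : ℝ)
    (hw : ∀ i j, β i ≠ 0 → β j ≠ 0 → star (w i) ⬝ᵥ w j = (Real.cos ((n j - n i) * x) : ℂ)) :
    ∑ s, ‖∑ i, β i * w i s‖ ^ 2
      = (‖∑ i, β i * Complex.exp ((n i * x : ℝ) * Complex.I)‖ ^ 2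
        + ‖∑ i, β i * Complex.exp ((n i * -x : ℝ) * Complex.I)‖ ^ 2) / 2 := by
  have hexp : ∀ x : ℝ, ((‖∑ i, β i * Complex.exp ((n i * x : ℝ) * Complex.I)‖ ^ 2 : ℝ) : ℂ)
      = ∑ i, ∑ j, star (β i) * β j * Complex.exp (((n j - n i) * x : ℝ) * Complex.I) := by
    intro x
    rw [Complex.ofReal_pow, ← Complex.conj_mul', map_sum, Finset.sum_mul_sum]
    refine Finset.sum_congr rfl fun i _ => Finset.sum_congr rfl fun j _ => ?_
    have e : (((n j - n i) * x : ℝ) : ℂ) * Complex.I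
        = (starRingEnd ℂ) ((n i * x : ℝ) * Complex.I) + (n j * x : ℝ) * Complex.I := by
      rw [map_mul, Complex.conj_ofReal, Complex.conj_I]
      push_cast
      ring
    rw [e, Complex.exp_add, Complex.exp_conj, map_mul, RCLike.star_def]
    ring
  have hlhs : ((∑ s, ‖∑ i, β i * w i s‖ ^ 2 : ℝ) : ℂ)
      = ∑ i, ∑ j, star (β i) * β j * (star (w i) ⬝ᵥ w j) := by
    simp only [Complex.ofReal_sum, Complex.ofReal_pow, ← Complex.conj_mul', map_sum,
      Finset.sum_mul_sum, dotProduct]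
    simp only [Finset.mul_sum]
    rw [Finset.sum_comm]
    refine Finset.sum_congr rfl fun i _ => ?_
    rw [Finset.sum_comm]
    refine Finset.sum_congr rfl fun j _ => Finset.sum_congr rfl fun s _ => ?_
    simp only [map_mul, RCLike.star_def, Pi.star_apply]
    ring
  apply Complex.ofReal_injective
  rw [hlhs, Complex.ofReal_div, Complex.ofReal_add, hexp, hexp, ← Finset.sum_add_distrib,
    Finset.sum_div]
  refine Finset.sum_congr rfl fun i _ => ?_
  rw [← Finset.sum_add_distrib, Finset.sum_div]
  refine Finset.sum_congr rfl fun j _ => ?_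
  by_cases hi : β i = 0
  · simp [hi]
  by_cases hj : β j = 0
  · simp [hj]
  rw [hw i j hi hj, Complex.ofReal_cos, Complex.cos]
  push_cast
  ring_nf

end Rotation

/-! ### The estimation protocol -/

/-- Every unit vector is the first column of a unitary matrix. -/
theorem exists_unitary_mulVec_ket {A : Type} [Fintype A] [DecidableEq A] (a₀ : A) (α : A → ℂ)
    (hα : ∑ a, ‖α a‖ ^ 2 = 1) :
    ∃ V : Matrix.unitaryGroup A ℂ, ∀ a, V.1 a a₀ = α a := by
  have hnorm : ‖WithLp.toLp 2 α‖ = 1 := by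
    rw [EuclideanSpace.norm_eq]
    simp [hα]
  have hon : Orthonormal ℂ
      (({a₀} : Set A).domRestrict fun _ : A => (WithLp.toLp 2 α : EuclideanSpace ℂ A)) := by
    refine ⟨fun i => hnorm, fun i j hij => ?_⟩
    exact absurd (Subsingleton.elim i j) hij
  obtain ⟨b, hb⟩ := hon.exists_orthonormalBasis_extension_of_card_eq (by simp)
  refine ⟨⟨_, (EuclideanSpace.basisFun A ℂ).toMatrix_orthonormalBasis_mem_unitary b⟩, fun a => ?_⟩
  simp [Module.Basis.toMatrix_apply, hb a₀ rfl]

section Protocol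

variable {L : ℕ} [NeZero L]

/-- Phase estimation of the amplified walk operator: a first unitary `V` on the ancilla prepares the
window, the `j`-th controlled walk acts if the ancilla exceeds `j`, so that its power is the value
of the ancilla if this is at most `N`, and a Fourier transform reads out the phase. If the walk is never used, the
system is not prepared either, so that no query is made. -/
def phaseEstimation (V : Matrix.unitaryGroup (ZMod L) ℂ) (N : ℕ) : List (Step (ZMod L)) :=
  (if N = 0 then [] else [.prepare]) ++ ([.ancilla V]
    ++ ((List.range N).map (fun j => .amplifiedWalk fun a => decide (j < a.val))
    ++ [.ancilla ⟨fourier L, fourier_mem_unitaryGroup L⟩]))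

variable {S : Type} [Fintype S] [DecidableEq S]

theorem protocolCircuit_append (s₀ : S) (μ : ℕ) (l₁ l₂ : List (Step (ZMod L))) :
    protocolCircuit s₀ μ (l₁ ++ l₂) = protocolCircuit s₀ μ l₁ ++ protocolCircuit s₀ μ l₂ := by
  simp [protocolCircuit]

theorem queries_phaseEstimation_le (s₀ : S) (μ : ℕ) (V : Matrix.unitaryGroup (ZMod L) ℂ) (N : ℕ) :
    (protocolCircuit s₀ μ (phaseEstimation V N) : Circuit S (ZMod L)).queries
      ≤ 4 * (2 * μ + 1) * N := by
  have hwalk : ∀ n : ℕ, (protocolCircuit s₀ μ ((List.range n).map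
      (fun j => Step.amplifiedWalk fun a : ZMod L => decide (j < a.val))) :
        Circuit S (ZMod L)).queries = 3 * (2 * μ + 1) * n := by
    intro n
    induction n with
    | zero => simp [protocolCircuit, Circuit.queries]
    | succ n ih =>
      rw [List.range_succ, List.map_append, protocolCircuit_append, Circuit.queries_append, ih]
      simp only [protocolCircuit, List.map_cons, List.map_nil, List.flatten_cons, List.flatten_nil,
        List.append_nil, Step.toCircuit, queries_amplifiedWalkCircuit]
      ring
  have hanc : ∀ U : Matrix.unitaryGroup (ZMod L) ℂ,
      (protocolCircuit s₀ μ [.ancilla U] : Circuit S (ZMod L)).queries = 0 := by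
    intro U
    simp [protocolCircuit, Step.toCircuit, ancillaGate, Circuit.queries, Gate.queries]
  have hprep : (protocolCircuit s₀ μ (if N = 0 then [] else [.prepare]) :
      Circuit S (ZMod L)).queries ≤ N := by
    split_ifs with h
    · simp [protocolCircuit, Circuit.queries]
    · simp only [protocolCircuit, List.map_cons, List.map_nil, List.flatten_cons, List.flatten_nil,
        List.append_nil, Step.toCircuit, Circuit.queries, Gate.queries, List.sum_cons, List.sum_nil]
      omega
  rw [phaseEstimation, protocolCircuit_append, protocolCircuit_append, protocolCircuit_append,
    Circuit.queries_append, Circuit.queries_append, Circuit.queries_append, hwalk, hanc, hanc]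
  nlinarith

theorem run_phaseEstimation (s₀ : S) (μ : ℕ) (O R : Matrix S S ℂ)
    (V : Matrix.unitaryGroup (ZMod L) ℂ) (N : ℕ) (s : S) (b : ZMod L) :
    (protocolCircuit s₀ μ (phaseEstimation V N) : Circuit S (ZMod L)).run O R (ket (s₀, 0)) (s, b)
      = ∑ j, fourier L b j * V.1 j 0 * ((walk s₀ O R ^ (2 * μ + 1)) ^ (min j.val N) *ᵥ
          if N = 0 then ket s₀ else O *ᵥ ket s₀) s := by
  set φ : S → ℂ := if N = 0 then ket s₀ else O *ᵥ ket s₀ with hφ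
  have hprep : Circuit.run O R (protocolCircuit s₀ μ (if N = 0 then [] else [.prepare]) :
      Circuit S (ZMod L)) (ket (s₀, 0)) = fun q => φ q.1 * ket 0 q.2 := by
    have hket : (ket (s₀, (0 : ZMod L)) : S × ZMod L → ℂ) = fun q => ket s₀ q.1 * ket 0 q.2 := by
      funext q
      obtain ⟨s, a⟩ := q
      by_cases h1 : s = s₀ <;> by_cases h2 : a = 0 <;> simp [ket, h1, h2]
    rw [hφ]
    split_ifs with h
    · simpa [protocolCircuit, Circuit.run] using hket
    · funext q
      obtain ⟨s, a⟩ := q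
      change (controlled (fun _ => true) O *ᵥ ket (s₀, (0 : ZMod L))) (s, a) = _
      rw [controlled_mulVec, if_pos rfl, hket]
      simp only [Matrix.mulVec, dotProduct, Finset.sum_mul, mul_assoc]
  have hanc : ∀ (U : Matrix.unitaryGroup (ZMod L) ℂ) (v : S × ZMod L → ℂ),
      Circuit.run O R (protocolCircuit s₀ μ [.ancilla U]) v
        = fun q => (U.1 *ᵥ fun a => v (q.1, a)) q.2 := by
    intro U v
    funext q
    obtain ⟨s, a⟩ := q
    simp only [protocolCircuit, List.map_cons, List.map_nil, List.flatten_cons, List.flatten_nil,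
        List.append_nil, Step.toCircuit, Circuit.run, List.foldl_cons, List.foldl_nil,
        ancillaGate, Gate.toMatrix, ancillaGate_mulVec]
  have hwalk : ∀ n : ℕ, Circuit.run O R (protocolCircuit s₀ μ ((List.range n).map
      (fun j => Step.amplifiedWalk fun a : ZMod L => decide (j < a.val))))
        (fun q : S × ZMod L => V.1 q.2 0 * φ q.1)
      = fun q => V.1 q.2 0 * ((walk s₀ O R ^ (2 * μ + 1)) ^ (min q.2.val n) *ᵥ φ) q.1 := by
    intro n
    induction n with
    | zero => simp [protocolCircuit, Circuit.run]
    | succ n ih =>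
      rw [List.range_succ, List.map_append, protocolCircuit_append, Circuit.run_append, ih]
      simp only [protocolCircuit, List.map_cons, List.map_nil, List.flatten_cons, List.flatten_nil,
        List.append_nil, Step.toCircuit, run_amplifiedWalkCircuit]
      funext q
      obtain ⟨s, a⟩ := q
      rw [controlled_mulVec]
      dsimp only
      by_cases h : n < a.val
      · rw [if_pos (by simpa using h), min_eq_right h.le, min_eq_right h,
          pow_succ' (walk s₀ O R ^ (2 * μ + 1)) n,
          ← Matrix.mulVec_mulVec]
        exact congrFun (Matrix.mulVec_smul _ (V.1 a 0) _) s
      · rw [if_neg (by simpa using h), min_eq_left (by omega), min_eq_left (by omega)]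
  have hwindow : Circuit.run O R (protocolCircuit s₀ μ [.ancilla V])
      (fun q => φ q.1 * ket 0 q.2) = fun q : S × ZMod L => V.1 q.2 0 * φ q.1 := by
    rw [hanc]
    funext q
    simp [Matrix.mulVec, dotProduct, ket, Pi.single_apply, mul_comm]
  rw [phaseEstimation, protocolCircuit_append, protocolCircuit_append, protocolCircuit_append,
    Circuit.run_append, Circuit.run_append, Circuit.run_append, hprep, hwindow,
    hwalk, hanc]
  simp only [Matrix.mulVec, dotProduct, mul_assoc]

/-- The outcome of phase estimation is distributed as an equal mixture of the readouts of the phases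
`± (2 μ + 1) y`, where `cos y = 1 - 2 p`. -/
theorem prob_phaseEstimation {s₀ : S} {μ N : ℕ} {O R Proj : Matrix S S ℂ} {p y : ℝ}
    {V : Matrix.unitaryGroup (ZMod L) ℂ} {α : ZMod L → ℂ} (hV : ∀ j, V.1 j 0 = α j)
    (hα : ∀ j, N < j.val → α j = 0)
    (hO : O ∈ Matrix.unitaryGroup S ℂ) (hProj : IsStarProjection Proj)
    (hR : Proj = (1 / 2 : ℂ) • (1 - R))
    (hp : star (O *ᵥ ket s₀) ⬝ᵥ Proj *ᵥ (O *ᵥ ket s₀) = (p : ℂ)) (hy : Real.cos y = 1 - 2 * p)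
    (b : ZMod L) :
    ∑ s, ‖(protocolCircuit s₀ μ (phaseEstimation V N) : Circuit S (ZMod L)).run O R
        (ket (s₀, 0)) (s, b)‖ ^ 2
      = (‖readout α ((2 * μ + 1) * y) b‖ ^ 2 + ‖readout α (-((2 * μ + 1) * y)) b‖ ^ 2) / 2 := by
  simp only [run_phaseEstimation, hV]
  rw [sum_norm_sq_sum_mul_of_cos (fun j => fourier L b j * α j) _ (fun j => (j.val : ℝ))
    ((2 * μ + 1) * y)]
  · simp only [readout, Matrix.mulVec, dotProduct, mul_assoc]
  intro i j hi hj
  have hi' : i.val ≤ N := not_lt.1 fun h => hi (by simp [hα i h])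
  have hj' : j.val ≤ N := not_lt.1 fun h => hj (by simp [hα j h])
  rw [min_eq_left hi', min_eq_left hj']
  split_ifs with h
  · have hi0 : i.val = 0 := by omega
    have hj0 : j.val = 0 := by omega
    simp only [hi0, hj0, pow_zero, Matrix.one_mulVec, star_ket_dotProduct_ket, sub_self, zero_mul,
      Real.cos_zero, Complex.ofReal_one]
  · rw [← pow_mul, ← pow_mul, star_walk_pow_mulVec_dotProduct hO hProj hR hp hy]
    push_cast
    ring_nf

end Protocol

/-! ### From the phase to the estimate -/

/-- Folding an angle to `[0, π]` by `arccos ∘ cos` undoes both the sign of the phase and the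
reduction modulo `2 π`, without increasing the error. -/
theorem abs_arccos_cos_sub_le {r x z : ℝ} (hr : r ≤ 1 / 2) (hx0 : 0 ≤ x) (hx : x ≤ Real.pi)
    (h : AngleClose r x z ∨ AngleClose r (-x) z) : |Real.arccos (Real.cos z) - x| ≤ r := by
  have hpi := Real.pi_gt_three
  obtain ⟨k, t, ht, hk⟩ : ∃ (k : ℤ) (t : ℝ), t = |z + 2 * Real.pi * k| ∧ |x - t| ≤ r := by
    rcases h with ⟨k, hk⟩ | ⟨k, hk⟩ <;> refine ⟨k, _, rfl, ?_⟩
    · have h1 := abs_abs_sub_abs_le x (z + 2 * Real.pi * k)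
      rw [abs_of_nonneg hx0, ← sub_sub] at h1
      exact h1.trans hk
    · have h1 := abs_abs_sub_abs_le (-x) (z + 2 * Real.pi * k)
      rw [abs_neg, abs_of_nonneg hx0, ← sub_sub] at h1
      exact h1.trans hk
  have hcos : Real.cos z = Real.cos t := by
    rw [ht, Real.cos_abs, mul_comm (2 * Real.pi), Real.cos_add_int_mul_two_pi]
  have ht0 : 0 ≤ t := ht ▸ abs_nonneg _
  rw [abs_le] at hk
  rw [hcos]
  rcases le_total t Real.pi with h | h
  · rw [Real.arccos_cos ht0 h, abs_le]
    constructor <;> linarith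
  · rw [← Real.cos_two_pi_sub, Real.arccos_cos (by linarith) (by linarith), abs_le]
    constructor <;> linarith

theorem sqrt_P0 {μ : ℕ} : √(P0 μ) = Real.sin (Real.pi / (2 * (2 * (μ : ℝ) + 1))) := by
  have hm : (0 : ℝ) ≤ μ := by positivity
  have hpi := Real.pi_pos
  refine Real.sqrt_sq (Real.sin_nonneg_of_nonneg_of_le_pi (by positivity) ?_)
  rw [div_le_iff₀ (by positivity)]
  nlinarith

theorem one_le_mul_sqrt_P0 (μ : ℕ) : 1 ≤ (2 * μ + 1) * √(P0 μ) := by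
  have hm : (0 : ℝ) ≤ μ := by positivity
  have hpi := Real.pi_pos
  rw [sqrt_P0]
  have h := Real.mul_le_sin (x := Real.pi / (2 * (2 * (μ : ℝ) + 1))) (by positivity)
    (by gcongr; linarith)
  calc (1 : ℝ) = (2 * μ + 1) * (2 / Real.pi * (Real.pi / (2 * (2 * (μ : ℝ) + 1)))) := by field_simp
    _ ≤ _ := by gcongr

theorem mul_sqrt_P0_le_two (μ : ℕ) : (2 * μ + 1) * √(P0 μ) ≤ 2 := by
  have hpi := Real.pi_pos
  rw [sqrt_P0]
  have h := Real.sin_le (x := Real.pi / (2 * (2 * (μ : ℝ) + 1))) (by positivity)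
  calc (2 * (μ : ℝ) + 1) * Real.sin (Real.pi / (2 * (2 * (μ : ℝ) + 1)))
      ≤ (2 * μ + 1) * (Real.pi / (2 * (2 * (μ : ℝ) + 1))) := by gcongr
    _ = Real.pi / 2 := by field_simp
    _ ≤ 2 := by linarith [Real.pi_le_four]

theorem P0_pos (μ : ℕ) : 0 < P0 μ := by
  refine Real.sqrt_pos.1 (pos_of_mul_pos_right (lt_of_lt_of_le one_pos (one_le_mul_sqrt_P0 μ)) ?_)
  positivity

/-- The value of `δ` when the amplified walk operator has phases `± x` on the prepared state. -/
def phaseToEstimate (μ : ℕ) (x : ℝ) : ℝ := Real.sin (x / (2 * (2 * μ + 1))) ^ 2 - P0 μ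

/-- An error `r` in the phase is an error `2 P₀ r` in `δ`. The factor `P₀` is the gain: one factor
`P₀ ^ (1 / 2)` since the walk is amplified, the other since the derivative of `sin²` is small. -/
theorem abs_phaseToEstimate_sub_le (μ : ℕ) {x y : ℝ} (hx0 : 0 ≤ x) (hx : x ≤ Real.pi)
    (hy0 : 0 ≤ y) (hy : y ≤ Real.pi) :
    |phaseToEstimate μ x - phaseToEstimate μ y| ≤ 2 * P0 μ * |x - y| := by
  have hpi := Real.pi_pos
  have hid : ∀ a b : ℝ, Real.sin a ^ 2 - Real.sin b ^ 2 = Real.sin (a - b) * Real.sin (a + b) := by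
    intro a b
    rw [Real.sin_sub, Real.sin_add]
    linear_combination Real.sin b ^ 2 * Real.sin_sq_add_cos_sq a
      - Real.sin a ^ 2 * Real.sin_sq_add_cos_sq b
  set m : ℝ := 2 * μ + 1 with hm
  have hm0 : 0 < m := by positivity
  have hP : 1 ≤ m ^ 2 * P0 μ := by
    have h := one_le_mul_sqrt_P0 μ
    have h2 : (m * √(P0 μ)) ^ 2 = m ^ 2 * P0 μ := by rw [mul_pow, Real.sq_sqrt (P0_pos μ).le]
    nlinarith
  have hsin : ∀ a : ℝ, |Real.sin a| ≤ |a| := fun a => Real.abs_sin_le_abs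
  unfold phaseToEstimate
  rw [← hm, sub_sub_sub_cancel_right, hid, abs_mul]
  have h1 : |x / (2 * m) + y / (2 * m)| ≤ Real.pi / m := by
    rw [abs_of_nonneg (by positivity)]
    calc x / (2 * m) + y / (2 * m) ≤ Real.pi / (2 * m) + Real.pi / (2 * m) := by gcongr
      _ = Real.pi / m := by field_simp; norm_num
  calc _ ≤ |x / (2 * m) - y / (2 * m)| * |x / (2 * m) + y / (2 * m)| :=
        mul_le_mul (hsin _) (hsin _) (abs_nonneg _) (abs_nonneg _)
    _ ≤ |x / (2 * m) - y / (2 * m)| * (Real.pi / m) := by gcongr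
    _ = Real.pi / 2 * (1 / m ^ 2) * |x - y| := by
        rw [← sub_div, abs_div, abs_of_pos (by positivity : 0 < 2 * m)]
        field_simp
    _ ≤ 2 * P0 μ * |x - y| := by
        have h2 : 1 / m ^ 2 ≤ P0 μ := by
          rw [div_le_iff₀ (by positivity)]
          linarith
        have h3 : Real.pi / 2 ≤ 2 := by linarith [Real.pi_le_four]
        gcongr

/-- Below the known bound `P₀` the phase of the amplified walk operator does not wrap around: it
lies in `[0, π]` and so determines `δ`. -/
theorem exists_phase {μ : ℕ} {δ : ℝ} (h1 : -P0 μ ≤ δ) (h2 : δ ≤ 0) :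
    ∃ y : ℝ, Real.cos y = 1 - 2 * (P0 μ + δ) ∧ 0 ≤ (2 * μ + 1) * y ∧
      (2 * μ + 1) * y ≤ Real.pi ∧ phaseToEstimate μ ((2 * μ + 1) * y) = δ := by
  have hpi := Real.pi_pos
  have hP1 : P0 μ ≤ 1 := Real.sin_sq_le_one _
  have hm : (0 : ℝ) ≤ μ := by positivity
  have hcos : Real.cos (Real.arccos (1 - 2 * (P0 μ + δ))) = 1 - 2 * (P0 μ + δ) :=
    Real.cos_arccos (by linarith) (by linarith)
  refine ⟨Real.arccos (1 - 2 * (P0 μ + δ)), hcos, ?_, ?_, ?_⟩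
  · have := Real.arccos_nonneg (1 - 2 * (P0 μ + δ))
    positivity
  · have h3 : Real.arccos (1 - 2 * (P0 μ + δ)) ≤ Real.pi / (2 * μ + 1) := by
      have h4 : Real.cos (Real.pi / (2 * μ + 1)) = 1 - 2 * P0 μ := by
        rw [P0, show Real.pi / (2 * (μ : ℝ) + 1) = 2 * (Real.pi / (2 * (2 * (μ : ℝ) + 1))) by
          field_simp, Real.cos_two_mul]
        linarith [Real.sin_sq_add_cos_sq (Real.pi / (2 * (2 * (μ : ℝ) + 1)))]
      rw [← Real.arccos_cos (x := Real.pi / (2 * μ + 1)) (by positivity)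
        (div_le_self hpi.le (by linarith)), h4]
      exact Real.arccos_le_arccos (by linarith)
    rw [le_div_iff₀ (by positivity)] at h3
    linarith
  · set y := Real.arccos (1 - 2 * (P0 μ + δ)) with hy
    have h3 : (2 * μ + 1) * y / (2 * (2 * μ + 1)) = y / 2 := by field_simp
    have h4 : Real.cos y = 2 * Real.cos (y / 2) ^ 2 - 1 := by
      rw [← Real.cos_two_mul]
      ring_nf
    rw [phaseToEstimate, h3]
    linarith [Real.sin_sq_add_cos_sq (y / 2)]

end

end AAE

theorem mainTheorem1 :
    -- `c` is the constant hidden in `ε ∈ O(P₀² / |δ|)`, `C` the one hidden in the query count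
    ∀ c : ℝ, 0 < c → ∃ C : ℝ, 0 < C ∧
      ∀ (μ : ℕ) (ε δ' : ℝ), 1 ≤ μ → 0 < ε → 0 < δ' → δ' < 1 →
        -- the algorithm: ancilla register, initial ancilla state, steps, classical output
        ∃ (A : Type) (_ : Fintype A) (_ : DecidableEq A) (a₀ : A)
          (steps : List (AAE.Step A)) (estimate : A → ℝ),
          ∀ (S : Type) [Fintype S] [DecidableEq S] (s₀ : S)
            (O R Proj : Matrix S S ℂ) (ψ : S → ℂ) (δ : ℝ),
            O ∈ Matrix.unitaryGroup S ℂ →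
            O *ᵥ AAE.ket s₀ = ψ →
            IsStarProjection Proj →
            Proj = (1 / 2 : ℂ) • (1 - R) →
            star ψ ⬝ᵥ Proj *ᵥ ψ = ((AAE.P0 μ + δ : ℝ) : ℂ) →
            -AAE.P0 μ ≤ δ → δ < 0 →
            ε ≤ c * (AAE.P0 μ ^ 2 / |δ|) →
            ((AAE.protocolCircuit s₀ μ steps : AAE.Circuit S A).queries : ℝ) ≤
                C * (Real.sqrt (AAE.P0 μ) * Real.log (1 / δ') / ε * (AAE.P0 μ / |δ|)) ∧
            AAE.measureProb
                ((AAE.protocolCircuit s₀ μ steps).run O R (AAE.ket (s₀, a₀)))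
                {a | ¬ (|estimate a - δ| ≤ ε ∧
                  ‖((AAE.P0 μ + estimate a : ℝ) : ℂ) - star ψ ⬝ᵥ Proj *ᵥ ψ‖ ≤ ε)}
              ≤ δ' := by
  intro c hc
  refine ⟨16000 * (2 + 2 * c), by positivity, fun μ ε δ' _ hε hδ hδ' => ?_⟩
  have hP := AAE.P0_pos μ
  -- The phase precision: it makes the error in `δ` at most `ε`, and its cap matters only when
  -- `ε > P₀`, where the assumption on `ε` pays for the queries.
  set r : ℝ := min (ε / (2 * AAE.P0 μ)) (1 / 2) with hr
  have hr0 : 0 < r := lt_min (by positivity) (by norm_num)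
  obtain ⟨L, _, N, α, hN, hα, hα1, hmiss⟩ := AAE.exists_window hr0 (min_le_right _ _) hδ hδ'
  obtain ⟨V, hV⟩ := AAE.exists_unitary_mulVec_ket (0 : ZMod L) α hα1
  refine ⟨ZMod L, inferInstance, inferInstance, 0, AAE.phaseEstimation V N,
    fun b => AAE.phaseToEstimate μ (Real.arccos (Real.cos (AAE.angle b))), ?_⟩
  intro S _ _ s₀ O R Proj ψ δ hO hψ hProj hR hp hδ1 hδ2 hεc
  have hd : 0 < |δ| := abs_pos.2 hδ2.ne
  have hdP : |δ| ≤ AAE.P0 μ := by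
    rw [abs_of_neg hδ2]
    linarith
  have hlog : 0 < Real.log (1 / δ') := Real.log_pos (one_lt_one_div hδ hδ')
  subst hψ
  constructor
  · have hq : ((AAE.protocolCircuit s₀ μ (AAE.phaseEstimation V N) :
        AAE.Circuit S (ZMod L)).queries : ℝ) ≤ 4 * (2 * μ + 1) * N := by
      exact_mod_cast AAE.queries_phaseEstimation_le s₀ μ V N
    have hrinv : 1 / r ≤ (2 + 2 * c) * (AAE.P0 μ / ε * (AAE.P0 μ / |δ|)) := by
      have h1 : 1 / r ≤ 2 * AAE.P0 μ / ε + 2 := by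
        rcases min_choice (ε / (2 * AAE.P0 μ)) (1 / 2) with h | h <;> rw [hr, h]
        · rw [one_div_div]
          linarith
        · have : 0 < 2 * AAE.P0 μ / ε := by positivity
          linarith
      have h2 : AAE.P0 μ / ε ≤ AAE.P0 μ / ε * (AAE.P0 μ / |δ|) :=
        le_mul_of_one_le_right (by positivity) ((one_le_div hd).2 hdP)
      have h3 : 1 ≤ c * (AAE.P0 μ / ε * (AAE.P0 μ / |δ|)) := by
        rw [← div_le_div_iff_of_pos_right hε, div_self hε.ne'] at hεc
        calc (1 : ℝ) ≤ c * (AAE.P0 μ ^ 2 / |δ|) / ε := hεc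
          _ = _ := by ring
      rw [mul_div_assoc] at h1
      linarith
    have hm : (2 * (μ : ℝ) + 1) ≤ 2 / √(AAE.P0 μ) := by
      rw [le_div_iff₀ (Real.sqrt_pos.2 hP)]
      exact AAE.mul_sqrt_P0_le_two μ
    have hsq : AAE.P0 μ / √(AAE.P0 μ) = √(AAE.P0 μ) := Real.div_sqrt
    calc _ ≤ 4 * (2 * μ + 1) * (N : ℝ) := hq
      _ ≤ 4 * (2 / √(AAE.P0 μ)) * (2000 * Real.log (1 / δ') / r) := by gcongr
      _ = 16000 / √(AAE.P0 μ) * Real.log (1 / δ') * (1 / r) := by ring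
      _ ≤ 16000 / √(AAE.P0 μ) * Real.log (1 / δ')
          * ((2 + 2 * c) * (AAE.P0 μ / ε * (AAE.P0 μ / |δ|))) := by gcongr
      _ = 16000 * (2 + 2 * c) * (AAE.P0 μ / √(AAE.P0 μ) * Real.log (1 / δ') / ε
          * (AAE.P0 μ / |δ|)) := by ring
      _ = _ := by rw [hsq]
  · obtain ⟨y, hy, hx0, hx, hest⟩ := AAE.exists_phase hδ1 hδ2.le
    have hgood : ∀ b : ZMod L, AAE.AngleClose r ((2 * μ + 1) * y) (AAE.angle b) ∨
        AAE.AngleClose r (-((2 * μ + 1) * y)) (AAE.angle b) →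
        |AAE.phaseToEstimate μ (Real.arccos (Real.cos (AAE.angle b))) - δ| ≤ ε := by
      intro b hb
      have h1 := AAE.abs_arccos_cos_sub_le (min_le_right _ _) hx0 hx hb
      have h2 := AAE.abs_phaseToEstimate_sub_le μ (Real.arccos_nonneg (Real.cos (AAE.angle b)))
        (Real.arccos_le_pi _) hx0 hx
      rw [hest] at h2
      refine h2.trans ?_
      calc _ ≤ 2 * AAE.P0 μ * (ε / (2 * AAE.P0 μ)) := by
            gcongr
            exact h1.trans (min_le_left _ _)
        _ = ε := by field_simp
    have hsame : ∀ e : ℝ, ‖((AAE.P0 μ + e : ℝ) : ℂ)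
        - star (O *ᵥ AAE.ket s₀) ⬝ᵥ Proj *ᵥ (O *ᵥ AAE.ket s₀)‖ = |e - δ| := by
      intro e
      rw [hp, ← Complex.ofReal_sub, Complex.norm_real, Real.norm_eq_abs]
      ring_nf
    simp only [hsame, and_self]
    have hprob := AAE.prob_phaseEstimation (μ := μ) hV hα hO hProj hR hp hy
    -- An outcome with a wrong estimate is far from both phases, so both readouts count it
    -- as missed.
    calc _ ≤ (AAE.missProb α r ((2 * μ + 1) * y) + AAE.missProb α r (-((2 * μ + 1) * y))) / 2 := by
          unfold AAE.measureProb AAE.missProb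
          rw [← Finset.sum_add_distrib, Finset.sum_div]
          refine Finset.sum_le_sum fun b _ => ?_
          by_cases hb : AAE.AngleClose r ((2 * μ + 1) * y) (AAE.angle b) ∨
              AAE.AngleClose r (-((2 * μ + 1) * y)) (AAE.angle b)
          · rw [Set.indicator_of_notMem (by simpa using hgood b hb)]
            positivity
          · rw [if_neg fun h => hb (Or.inl h), if_neg fun h => hb (Or.inr h), ← hprob]
            exact Set.indicator_apply_le' (fun _ => le_rfl) fun _ => by positivity
      _ ≤ δ' := by linarith [hmiss ((2 * μ + 1) * y), hmiss (-((2 * μ + 1) * y))]
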